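/- Let $p$ be a prime and let $k$ be a field of characteristic $p$. For a field $K$ write $\mathrm{Gal}(K)$ for its absolute Galois group $\mathrm{Gal}(K^{\mathrm{sep}}/K)$. Let $S$ be a finite set of pairwise non-equivalent valuations of rank $1$ of $k$ (that is, non-trivial valuations whose value group is isomorphic to an ordered subgroup of $\mathbb{R}$). For $v\in S$ let $k_v$ be the completion of $k$ at $v$, fix an embedding $k^{\mathrm{sep}}\hookrightarrow k_v^{\mathrm{sep}}$ over $k$, and let $\phi_v:\mathrm{Gal}(k_v)\to \mathrm{Gal}(k)$ be the resulting restriction homomorphism. (1) The family $\phi_S=\{\phi_v\}_{v\in S}$ is $p$-dominating: for every finite elementary abelian $p$-group $P$ on which $\mathrm{Gal}(k)$ acts continuously, the restriction map $$\phi_S^*: H^1(\mathrm{Gal}(k),P)\to \prod_{v\in S} H^1(\mathrm{Gal}(k_v),P)$$ is surjective. Here $\mathrm{Gal}(k_v)$ acts on $P$ through $\phi_v$, and $H^1$ is continuous cohomology with $P$ discrete. (2) If there is a rank-$1$ valuation $w$ of $k$, not equivalent to any $v\in S$, whose value group $\Gamma_w$ (written additively) is not $p$-divisible, i.e. $p\,\Gamma_w\neq\Gamma_w$,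 then $\phi_S$ is strongly $p$-dominating: for every non-trivial finite elementary abelian $p$-group $P$ on which $\mathrm{Gal}(k)$ acts continuously, $\phi_S^*$ is surjective and its kernel is infinite. -/

import Mathlib

/-! ### Continuous cohomology in degree one with coefficients in a discrete module -/

section Cohomology

variable {G P : Type*} [Group G] [TopologicalSpace G] [AddCommGroup P] [TopologicalSpace P]

/-- An action of a topological group `G` on a topological abelian group `P` by additive maps,
given as a homomorphism to `End(P)`, is continuous if `G × P → P` is. -/
def IsContinuousAction (ρ : G →* AddMonoid.End P) : Prop :=
  Continuous fun x : G × P => ρ x.1 x.2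

/-- The continuous `1`-cocycles (crossed homomorphisms): the continuous maps `c : G → P` with
`c (g h) = c g + g • c h`. Here `P` is discrete. -/
def contCocycles₁ [DiscreteTopology P] (ρ : G →* AddMonoid.End P) : AddSubgroup (G → P) where
  carrier := {c | Continuous c ∧ ∀ g h, c (g * h) = c g + ρ g (c h)}
  zero_mem' := ⟨continuous_const, fun g h => by simp⟩
  add_mem' := fun {a b} ha hb => ⟨ha.1.add hb.1, fun g h => by
    simp only [Pi.add_apply, ha.2, hb.2, map_add]; abel⟩
  neg_mem' := fun {a} ha => ⟨ha.1.neg, fun g h => by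
    simp only [Pi.neg_apply, ha.2, map_neg]; abel⟩

/-- The `1`-coboundaries `g ↦ g • a - a`, as a subgroup of the continuous `1`-cocycles. (For a
continuous action they are automatically continuous.) -/
def contCoboundaries₁ [DiscreteTopology P] (ρ : G →* AddMonoid.End P) :
    AddSubgroup (contCocycles₁ ρ) where
  carrier := {c | ∃ a : P, ∀ g, c.1 g = ρ g a - a}
  zero_mem' := ⟨0, fun g => by simp⟩
  add_mem' := by
    rintro x y ⟨a, ha⟩ ⟨b, hb⟩
    exact ⟨a + b, fun g => by
      simp only [AddSubgroup.coe_add, Pi.add_apply, ha, hb, map_add]; abel⟩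
  neg_mem' := by
    rintro x ⟨a, ha⟩
    exact ⟨-a, fun g => by
      simp only [AddSubgroup.coe_neg, Pi.neg_apply, ha, map_neg]; abel⟩

/-- The first continuous cohomology group `H¹(G, P)` of the discrete module `P`. -/
abbrev ContH1 [DiscreteTopology P] (ρ : G →* AddMonoid.End P) : Type _ :=
  contCocycles₁ ρ ⧸ contCoboundaries₁ ρ

variable {H : Type*} [Group H] [TopologicalSpace H]

/-- Pullback of continuous `1`-cocycles along a continuous homomorphism `φ : H → G`, where `H`
acts on `P` through `φ`. -/
def contCocycles₁Pullback [DiscreteTopology P] (ρ : G →* AddMonoid.End P) (φ : H →ₜ* G) :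
    contCocycles₁ ρ →+ contCocycles₁ (ρ.comp φ.toMonoidHom) where
  toFun c := ⟨fun h => c.1 (φ h), c.2.1.comp φ.continuous_toFun, fun g h =>
    (congrArg c.1 (map_mul φ g h)).trans (c.2.2 (φ g) (φ h))⟩
  map_zero' := rfl
  map_add' _ _ := rfl

/-- The map `φ^* : H¹(G, P) → H¹(H, P)` induced by a continuous homomorphism `φ : H → G`. -/
def ContH1.pullback [DiscreteTopology P] (ρ : G →* AddMonoid.End P) (φ : H →ₜ* G) :
    ContH1 ρ →+ ContH1 (ρ.comp φ.toMonoidHom) :=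
  QuotientAddGroup.map _ _ (contCocycles₁Pullback ρ φ) (by
    rintro c ⟨a, ha⟩
    exact ⟨a, fun h => ha (φ h)⟩)

/-- The map `φ^* : H¹(G, P) → ∏_j H¹(H_j, P)` induced by a family `φ_j : H_j → G`. -/
def ContH1.pullbackPi {J : Type*} {H : J → Type*} [∀ j, Group (H j)]
    [∀ j, TopologicalSpace (H j)] [DiscreteTopology P] (ρ : G →* AddMonoid.End P)
    (φ : ∀ j, H j →ₜ* G) :
    ContH1 ρ →+ ∀ j, ContH1 (ρ.comp (φ j).toMonoidHom) where
  toFun c j := ContH1.pullback ρ (φ j) c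
  map_zero' := funext fun j => map_zero (ContH1.pullback ρ (φ j))
  map_add' a b := funext fun j => map_add (ContH1.pullback ρ (φ j)) a b

end Cohomology

/-! ### Dominating families -/

section Dominating

universe u

variable {G J : Type*} {H : J → Type*} [Group G] [TopologicalSpace G]
  [∀ j, Group (H j)] [∀ j, TopologicalSpace (H j)]

/-- A family `φ_j : H_j → G` is `p`-dominating if `H¹(G, P) → ∏_j H¹(H_j, P)` is surjective for
every finite elementary abelian `p`-group `P` on which `G` acts continuously. -/
def IsPDominating (p : ℕ) (φ : ∀ j, H j →ₜ* G) : Prop :=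
  ∀ (P : Type u) [AddCommGroup P] [Finite P] [TopologicalSpace P] [DiscreteTopology P]
    (ρ : G →* AddMonoid.End P), IsContinuousAction ρ → (∀ x : P, p • x = 0) →
      Function.Surjective (ContH1.pullbackPi ρ φ)

/-- A family `φ_j : H_j → G` is strongly `p`-dominating if `H¹(G, P) → ∏_j H¹(H_j, P)` is
surjective with infinite kernel for every non-trivial finite elementary abelian `p`-group `P` on
which `G` acts continuously. -/
def IsStronglyPDominating (p : ℕ) (φ : ∀ j, H j →ₜ* G) : Prop :=
  ∀ (P : Type u) [AddCommGroup P] [Finite P] [Nontrivial P] [TopologicalSpace P]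
    [DiscreteTopology P] (ρ : G →* AddMonoid.End P), IsContinuousAction ρ → (∀ x : P, p • x = 0) →
      Function.Surjective (ContH1.pullbackPi ρ φ) ∧ Infinite (ContH1.pullbackPi ρ φ).ker

end Dominating

/-! ### Absolute Galois groups, and restriction along an embedding of separable closures -/

section Galois

/-- The absolute Galois group of `k`, with the Krull topology. -/
abbrev AbsGal (k : Type*) [Field k] : Type _ := Gal(SeparableClosure k/k)

variable {k K : Type*} [Field k] [Field K] [Algebra k K]

/-- The automorphism of a separable closure of `k` obtained by restricting an automorphism `σ` of a
separable closure of `K` along a `k`-embedding `e`; see `absGalRestrictAux_spec`. -/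
noncomputable def absGalRestrictAux (e : SeparableClosure k →ₐ[k] SeparableClosure K)
    (σ : AbsGal K) : AbsGal k :=
  letI : Algebra (SeparableClosure k) (SeparableClosure K) := e.toRingHom.toAlgebra
  haveI : IsScalarTower k (SeparableClosure k) (SeparableClosure K) :=
    IsScalarTower.of_algebraMap_eq fun x => (e.commutes x).symm
  (σ.restrictScalars k).restrictNormal (SeparableClosure k)

theorem absGalRestrictAux_spec (e : SeparableClosure k →ₐ[k] SeparableClosure K) (σ : AbsGal K)
    (x : SeparableClosure k) : e (absGalRestrictAux e σ x) = σ (e x) := by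
  let _ : Algebra (SeparableClosure k) (SeparableClosure K) := e.toRingHom.toAlgebra
  have : IsScalarTower k (SeparableClosure k) (SeparableClosure K) :=
    IsScalarTower.of_algebraMap_eq fun x => (e.commutes x).symm
  exact (σ.restrictScalars k).restrictNormal_commutes (SeparableClosure k) x

/-- Restriction along a `k`-embedding `e`, as a homomorphism of groups. -/
noncomputable def absGalRestrictHom (e : SeparableClosure k →ₐ[k] SeparableClosure K) :
    AbsGal K →* AbsGal k :=
  MonoidHom.mk' (absGalRestrictAux e) fun σ τ => AlgEquiv.ext fun x => e.injective <| by
    change e _ = e _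
    rw [absGalRestrictAux_spec, AlgEquiv.mul_apply, AlgEquiv.mul_apply, absGalRestrictAux_spec,
      absGalRestrictAux_spec]

theorem absGalRestrictHom_continuous (e : SeparableClosure k →ₐ[k] SeparableClosure K) :
    Continuous (absGalRestrictHom e) := by
  refine continuous_of_continuousAt_one _ ?_
  rw [ContinuousAt, map_one, Filter.tendsto_def]
  intro U hU
  obtain ⟨E, hE, hEU⟩ := (krullTopology_mem_nhds_one_iff _ _ U).1 hU
  obtain ⟨s, hs⟩ := IntermediateField.essFiniteType_iff.1 (inferInstance : Algebra.EssFiniteType k E)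
  have hint : ∀ y ∈ e '' (s : Set (SeparableClosure k)), IsIntegral K y :=
    fun y _ => Algebra.IsIntegral.isIntegral y
  have : FiniteDimensional K
      (IntermediateField.adjoin K (e '' (s : Set (SeparableClosure k)))) :=
    IntermediateField.finiteDimensional_adjoin hint
  refine (krullTopology_mem_nhds_one_iff _ _ _).2
    ⟨IntermediateField.adjoin K (e '' (s : Set (SeparableClosure k))), inferInstance, ?_⟩
  intro σ hσ
  refine hEU ?_
  change absGalRestrictAux e σ ∈ E.fixingSubgroup
  have hle : E ≤ IntermediateField.fixedField (Subgroup.zpowers (absGalRestrictAux e σ)) := by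
    rw [← hs, IntermediateField.adjoin_le_iff]
    intro x hx
    have hfix : absGalRestrictAux e σ x = x := e.injective <| by
      change e _ = e _
      rw [absGalRestrictAux_spec]
      exact (IntermediateField.mem_fixingSubgroup_iff _ σ).1 hσ _
        (IntermediateField.subset_adjoin _ _ ⟨x, hx, rfl⟩)
    rw [SetLike.mem_coe, IntermediateField.mem_fixedField_iff]
    intro τ hτ
    have : Subgroup.zpowers (absGalRestrictAux e σ) ≤ MulAction.stabilizer (AbsGal k) x := by
      rw [Subgroup.zpowers_le]; exact hfix
    exact this hτ
  exact (IntermediateField.le_iff_le _ _).1 hle (Subgroup.mem_zpowers _)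

/-- The homomorphism `Gal(K) → Gal(k)` of profinite groups given by restriction along a
`k`-embedding `e` of separable closures: it is characterised by `e (absGalRestrict e σ x) = σ (e x)`,
see `absGalRestrict_spec`. -/
noncomputable def absGalRestrict (e : SeparableClosure k →ₐ[k] SeparableClosure K) :
    AbsGal K →ₜ* AbsGal k :=
  ⟨absGalRestrictHom e, absGalRestrictHom_continuous e⟩

theorem absGalRestrict_spec (e : SeparableClosure k →ₐ[k] SeparableClosure K) (σ : AbsGal K)
    (x : SeparableClosure k) : e (absGalRestrict e σ x) = σ (e x) :=
  absGalRestrictAux_spec e σ x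

end Galois

/-! ### Valuations and completions -/

section Valuations

variable {k : Type*} [Field k] {Γ : Type*} [LinearOrderedCommGroupWithZero Γ]

/-- Scaling by an element of `k` is uniformly continuous for the topology of a valuation of `k`.
Through this instance, Mathlib's completion `v.Completion` becomes a `k`-algebra in the canonical
way, see `algebraMap_valuation_completion`. -/
instance instUniformContinuousConstSMulWithVal (v : Valuation k Γ) :
    UniformContinuousConstSMul k (WithVal v) :=
  ⟨fun a => uniformContinuous_const_smul (WithVal.toVal v a)⟩

theorem algebraMap_valuation_completion (v : Valuation k Γ) (x : k) :
    algebraMap k v.Completion x = ((WithVal.toVal v x : WithVal v) : v.Completion) :=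
  rfl

/-- The value group of `v` (written multiplicatively) is `p`-divisible: every element is a `p`-th
power. -/
def Valuation.HasPDivisibleValueGroup (p : ℕ) (v : Valuation k Γ) : Prop :=
  ∀ γ : MonoidWithZeroHom.valueGroup (MonoidWithZeroHom.ofClass v), ∃ δ, δ ^ p = γ

end Valuations

/-! The group `P` embeds equivariantly in `k^sep` as a finite additive subgroup, and the monic
polynomial `f` whose roots are its elements has coefficients in `k`, is additive and has a nonzero
constant derivative. Thus `0 → P → k^sep → k^sep → 0`, with second map `f`, is exact. Since additive
Hilbert 90 kills `H¹` of the separable closure, `H¹(Gal(K), P) = K / f(K)` for `K = k` and for `K =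
k_v`. Restriction becomes the map `k / f(k) → ∏ k_v / f(k_v)`.

By the inverse function theorem `f(k_v)` contains a neighbourhood of `0`, and by weak approximation
an element of `k` can be brought close to given elements of all the `k_v` at once. This gives
surjectivity.

For the kernel, weak approximation at `w` and all `v` gives `y n` in `k` lying in every `f(k_v)`,
with `w (y n)` large, strictly increasing and never a `p`-th power. For large values `w (f r) = w r
^ |P|`, a `p`-th power because `p` divides `|P|`. Hence no difference `y n' - y n` with `n < n'`
lies in `f(k)`, and the classes are distinct.

The main steps are `exists_equivariant_embedding`, `rootsPoly_comp_X_add_C`,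
`exists_forall_eq_apply_sub`, `Valuation.eventually_exists_eval_eq`,
`AbsoluteValue.exists_forall_sub_lt` and `Valuation.exists_forall_lt_eval`. -/

/-! ### Rank-one valuations: absolute values, completions, weak approximation -/

section ValuationTopology

open Topology

namespace Valuation

variable {k : Type*} [Field k] {Γ : Type*} [LinearOrderedCommGroupWithZero Γ] (v : Valuation k Γ)
  [hv : v.RankOne]

/-- The real absolute value attached to a valuation of rank one. -/
noncomputable def toAbsoluteValue : AbsoluteValue k ℝ where
  toFun := v.norm
  map_mul' x y := by simp [Valuation.norm_def]
  nonneg' := v.norm_nonneg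
  eq_zero' x := ⟨v.norm_eq_zero, by rintro rfl; simp [Valuation.norm_def]⟩
  add_le' x y := (v.norm_add_le x y).trans
    (max_le_add_of_nonneg (v.norm_nonneg x) (v.norm_nonneg y))

theorem toAbsoluteValue_le_iff {x y : k} :
    v.toAbsoluteValue x ≤ v.toAbsoluteValue y ↔ v x ≤ v y := by
  change v.norm x ≤ v.norm y ↔ _
  rw [Valuation.norm_def, Valuation.norm_def, NNReal.coe_le_coe,
    (RankOne.strictMono v).le_iff_le, v.restrict_le_iff]

theorem toAbsoluteValue_lt_iff {x y : k} :
    v.toAbsoluteValue x < v.toAbsoluteValue y ↔ v x < v y :=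
  lt_iff_lt_of_le_iff_le v.toAbsoluteValue_le_iff

theorem toAbsoluteValue_eq_iff {x y : k} :
    v.toAbsoluteValue x = v.toAbsoluteValue y ↔ v x = v y := by
  simp only [le_antisymm_iff, toAbsoluteValue_le_iff]

theorem toAbsoluteValue_isNontrivial : v.toAbsoluteValue.IsNontrivial := by
  obtain ⟨x, h0, h1⟩ := RankOne.nontrivial v
  refine ⟨x, (Valuation.ne_zero_iff v).1 h0, fun h => h1 ?_⟩
  rw [← map_one v, ← v.toAbsoluteValue_eq_iff, h, map_one]

theorem isEquiv_of_toAbsoluteValue_isEquiv {Δ : Type*} [LinearOrderedCommGroupWithZero Δ]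
    (w : Valuation k Δ) [w.RankOne] (h : v.toAbsoluteValue.IsEquiv w.toAbsoluteValue) :
    v.IsEquiv w := fun x y => by
  rw [← toAbsoluteValue_le_iff, ← toAbsoluteValue_le_iff]
  exact h x y

/-- The powers of an element of absolute value greater than `1` are distinct. Infinitude of `k` is
what makes room for an arbitrary finite `P`. -/
theorem infinite_of_rankOne (v : Valuation k Γ) [v.RankOne] : Infinite k := by
  obtain ⟨x, hx⟩ := v.toAbsoluteValue_isNontrivial.exists_abv_gt_one
  refine Infinite.of_injective (fun n : ℕ => x ^ n) fun m n h => ?_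
  have h' := congrArg v.toAbsoluteValue h
  simp only [map_pow] at h'
  exact (pow_right_strictMono₀ hx).injective h'

/-- Makes `Valued.toNormedField` available, so that the completion is a complete normed field; by
`norm_toVal` its norm extends `v.toAbsoluteValue`. -/
noncomputable instance rankOneWithVal : (Valued.v : Valuation (WithVal v) Γ).RankOne where
  hom' := (RankOne.hom v).comp
    (WithVal.valueGroupOrderIso₀ v).toMulEquiv.toMonoidWithZeroHom
  strictMono' := (RankOne.strictMono v).comp (WithVal.strictMono_valueGroupOrderIso₀ v)
  exists_val_nontrivial := by
    obtain ⟨x, h⟩ := RankOne.nontrivial v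
    exact ⟨WithVal.toVal v x, h⟩

theorem norm_toVal (x : k) :
    (Valued.v : Valuation (WithVal v) Γ).norm (WithVal.toVal v x) = v.toAbsoluteValue x := by
  change _ = v.norm x
  rw [Valuation.norm_def, Valuation.norm_def, ← WithVal.valueGroupOrderIso₀_symm_restrict]
  change ((RankOne.hom v (WithVal.valueGroupOrderIso₀ v _) : NNReal) : ℝ) = _
  rw [OrderMonoidIso.apply_symm_apply]

/-- Every neighbourhood in the completion contains the image of a ball of the field. -/
theorem exists_ball_subset_of_mem_nhds {t : v.Completion} {U : Set v.Completion} (hU : U ∈ 𝓝 t) :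
    ∃ z : k, ∃ ε > 0, ∀ y : k, v.toAbsoluteValue (y - z) < ε → algebraMap k v.Completion y ∈ U := by
  obtain ⟨V, hVU, hV, htV⟩ := _root_.mem_nhds_iff.1 hU
  obtain ⟨z, hz⟩ := (UniformSpace.Completion.denseRange_coe (α := WithVal v)).exists_mem_open hV
    ⟨t, htV⟩
  let _ : NormedField (WithVal v) := Valued.toNormedField (WithVal v) Γ
  have hW : ((↑) : WithVal v → v.Completion) ⁻¹' V ∈ 𝓝 z :=
    (hV.preimage (UniformSpace.Completion.continuous_coe (WithVal v))).mem_nhds hz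
  obtain ⟨ε, hε, h⟩ := Metric.mem_nhds_iff.1 hW
  refine ⟨z.ofVal, ε, hε, fun y hy => hVU (h (a := WithVal.toVal v y) ?_)⟩
  rw [Metric.mem_ball, dist_eq_norm]
  change (Valued.v : Valuation (WithVal v) Γ).norm (WithVal.toVal v (y - z.ofVal)) < ε
  rwa [norm_toVal]

end Valuation

-- Inverse function theorem: an invertible strict derivative at `0` carries the neighbourhood filter
-- of `0` onto that of `f 0 = 0`.
open Polynomial in
theorem NontriviallyNormedField.eventually_exists_eval_eq {F : Type*} [NontriviallyNormedField F]
    [CompleteSpace F] {f : F[X]} (h0 : f.eval 0 = 0) (hd : f.derivative.eval 0 ≠ 0) :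
    ∀ᶠ y in 𝓝 (0 : F), ∃ u, f.eval u = y := by
  have h := (f.hasStrictDerivAt 0).map_nhds_eq hd
  rw [h0] at h
  rw [← h, Filter.eventually_map]
  exact Filter.Eventually.of_forall fun u => ⟨u, rfl⟩

open Polynomial in
/-- A weak form of Hensel's lemma: a polynomial over the completion with simple root `0` takes all
values close to `0`. -/
theorem Valuation.eventually_exists_eval_eq {k : Type*} [Field k] {Γ : Type*}
    [LinearOrderedCommGroupWithZero Γ] (v : Valuation k Γ) [v.RankOne] {f : v.Completion[X]}
    (h0 : f.eval 0 = 0) (hd : f.derivative.eval 0 ≠ 0) :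
    ∀ᶠ y in 𝓝 (0 : v.Completion), ∃ u, f.eval u = y := by
  let _ : NormedField (WithVal v) := Valued.toNormedField (WithVal v) Γ
  let _ : NontriviallyNormedField v.Completion := NontriviallyNormedField.ofNormNeOne (by
    obtain ⟨x, h0, h1⟩ := v.toAbsoluteValue_isNontrivial
    have hx : ‖((WithVal.toVal v x : WithVal v) : v.Completion)‖ = v.toAbsoluteValue x := by
      rw [UniformSpace.Completion.norm_coe]
      exact v.norm_toVal x
    refine ⟨((WithVal.toVal v x : WithVal v) : v.Completion), ?_, ?_⟩
    · rw [← norm_ne_zero_iff, hx]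
      exact v.toAbsoluteValue.ne_zero h0
    · rwa [hx])
  exact NontriviallyNormedField.eventually_exists_eval_eq h0 hd

/-- Weak approximation with centers in the field. -/
theorem AbsoluteValue.exists_forall_sub_lt {k ι : Type*} [Field k] [Finite ι]
    {a : ι → AbsoluteValue k ℝ} (h : ∀ i, (a i).IsNontrivial)
    (ha : Pairwise fun i j => ¬ (a i).IsEquiv (a j)) (z : ι → k) {ε : ι → ℝ} (hε : ∀ i, 0 < ε i) :
    ∃ y : k, ∀ i, a i (y - z i) < ε i := by
  have := Fintype.ofFinite ι
  obtain ⟨x, hx, y, rfl⟩ := (AbsoluteValue.denseRange_algebraMap_pi h ha).inter_open_nonempty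
    (Set.univ.pi fun i => Metric.ball (WithAbs.toAbs (a i) (z i)) (ε i))
    (isOpen_set_pi Set.finite_univ fun i _ => Metric.isOpen_ball)
    ⟨fun i => WithAbs.toAbs (a i) (z i), fun i _ => Metric.mem_ball_self (hε i)⟩
  refine ⟨y, fun i => ?_⟩
  have := hx i trivial
  rw [Metric.mem_ball, dist_eq_norm] at this
  exact this

end ValuationTopology

/-! ### Additive polynomials with a prescribed finite group of roots -/

section AdditivePolynomial

open Polynomial

variable {E P : Type*} [Field E] [AddCommGroup P] [Fintype P]

/-- The monic polynomial whose roots are the values of `j : P → E`. -/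
noncomputable def rootsPoly (j : P →+ E) : E[X] :=
  ∏ a, (X - C (j a))

theorem rootsPoly_monic (j : P →+ E) : (rootsPoly j).Monic :=
  monic_prod_X_sub_C _ _

theorem rootsPoly_natDegree (j : P →+ E) : (rootsPoly j).natDegree = Fintype.card P := by
  rw [rootsPoly, natDegree_finsetProd_X_sub_C_eq_card, Finset.card_univ]

theorem rootsPoly_map {F : Type*} [Field F] (j : P →+ E) (g : E →+* F) :
    (rootsPoly j).map g = rootsPoly (g.toAddMonoidHom.comp j) := by
  simp [rootsPoly, Polynomial.map_prod]

theorem eval_rootsPoly_eq_zero_iff (j : P →+ E) {x : E} :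
    (rootsPoly j).eval x = 0 ↔ ∃ a, x = j a := by
  simp [rootsPoly, eval_prod, Finset.prod_eq_zero_iff, sub_eq_zero]

theorem eval_rootsPoly_add_root (j : P →+ E) (x : E) (a : P) :
    (rootsPoly j).eval (x + j a) = (rootsPoly j).eval x := by
  simp only [rootsPoly, eval_prod, eval_sub, eval_X, eval_C]
  refine Fintype.prod_equiv (Equiv.subRight a) _ _ fun b => ?_
  simp only [Equiv.subRight_apply, map_sub]
  ring

/-- Both sides are monic of degree `|P|`, so their difference has smaller degree; by invariance
under translation by roots it vanishes at all `|P|` points `j a`. -/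
theorem rootsPoly_comp_X_add_C {j : P →+ E} (hj : Function.Injective j) (y : E) :
    (rootsPoly j).comp (X + C y) = rootsPoly j + C ((rootsPoly j).eval y) := by
  classical
  have hc : (Finset.univ.image j).card = Fintype.card P := by
    rw [Finset.card_image_of_injective _ hj, Finset.card_univ]
  have hm := rootsPoly_monic j
  have hm' : (rootsPoly j + C ((rootsPoly j).eval y)).Monic := by
    refine hm.add_of_left (degree_C_le.trans_lt ?_)
    rw [← natDegree_pos_iff_degree_pos, rootsPoly_natDegree]
    exact Fintype.card_pos
  have hd : (rootsPoly j + C ((rootsPoly j).eval y)).natDegree = Fintype.card P := by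
    rw [natDegree_add_C, rootsPoly_natDegree]
  have hm'' : ((rootsPoly j).comp (X + C y)).Monic := hm.comp_X_add_C y
  have hd'' : ((rootsPoly j).comp (X + C y)).natDegree = Fintype.card P := by
    rw [natDegree_comp, natDegree_X_add_C, mul_one, rootsPoly_natDegree]
  refine eq_of_degree_sub_lt_of_eval_finset_eq (Finset.univ.image j) ?_ ?_
  · rw [hc, ← hd'', ← degree_eq_natDegree hm''.ne_zero]
    refine degree_sub_lt_left ?_ hm''.ne_zero ?_
    · rw [degree_eq_natDegree hm''.ne_zero, degree_eq_natDegree hm'.ne_zero, hd, hd'']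
    · rw [hm''.leadingCoeff, hm'.leadingCoeff]
  · intro x hx
    obtain ⟨a, -, rfl⟩ := Finset.mem_image.1 hx
    have h0 : (rootsPoly j).eval (j a) = 0 := (eval_rootsPoly_eq_zero_iff j).2 ⟨a, rfl⟩
    simp only [eval_comp, eval_add, eval_X, eval_C, h0, zero_add]
    rw [add_comm, eval_rootsPoly_add_root]

theorem eval_rootsPoly_add {j : P →+ E} (hj : Function.Injective j) (x y : E) :
    (rootsPoly j).eval (x + y) = (rootsPoly j).eval x + (rootsPoly j).eval y := by
  simpa using congrArg (eval x) (rootsPoly_comp_X_add_C hj y)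

theorem eval_rootsPoly_sub {j : P →+ E} (hj : Function.Injective j) (x y : E) :
    (rootsPoly j).eval (x - y) = (rootsPoly j).eval x - (rootsPoly j).eval y := by
  rw [eq_sub_iff_add_eq, ← eval_rootsPoly_add hj, sub_add_cancel]

theorem eval_derivative_rootsPoly {j : P →+ E} (hj : Function.Injective j) (y : E) :
    (rootsPoly j).derivative.eval y = (rootsPoly j).derivative.eval 0 := by
  simpa [derivative_comp] using
    congrArg (fun q => q.derivative.eval 0) (rootsPoly_comp_X_add_C hj y)

theorem eval_zero_derivative_rootsPoly_ne_zero {j : P →+ E} (hj : Function.Injective j) :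
    (rootsPoly j).derivative.eval 0 ≠ 0 := by
  have hs : (rootsPoly j).Separable := separable_prod_X_sub_C_iff.2 hj
  have h0 : (rootsPoly j).eval 0 = 0 := (eval_rootsPoly_eq_zero_iff j).2 ⟨0, by simp⟩
  have h := hs.eval₂_derivative_ne_zero (RingHom.id E) (x := 0) h0
  rwa [eval₂_id] at h

/-- Additivity makes the derivative constant, and it is nonzero because the roots are simple.
Subtracting `y` does not change it. -/
theorem rootsPoly_sub_C_separable [Infinite E] {j : P →+ E} (hj : Function.Injective j) (y : E) :
    (rootsPoly j - C y).Separable := by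
  have hd : (rootsPoly j).derivative = C ((rootsPoly j).derivative.eval 0) :=
    Polynomial.funext fun x => by rw [eval_C, eval_derivative_rootsPoly hj]
  rw [Polynomial.Separable, derivative_sub, derivative_C, sub_zero, hd]
  exact (isCoprime_one_right.of_isCoprime_of_dvd_right
    (isUnit_iff_dvd_one.1 (isUnit_C.2 (eval_zero_derivative_rootsPoly_ne_zero hj).isUnit)))

theorem exists_eval_rootsPoly_eq [Infinite E] [IsSepClosed E] {j : P →+ E}
    (hj : Function.Injective j) (y : E) : ∃ x, (rootsPoly j).eval x = y := by
  obtain ⟨x, hx⟩ := IsSepClosed.exists_root (rootsPoly j - C y) (by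
    rw [degree_sub_C, degree_eq_natDegree (rootsPoly_monic j).ne_zero, rootsPoly_natDegree]
    · exact_mod_cast Fintype.card_ne_zero
    · rw [← natDegree_pos_iff_degree_pos, rootsPoly_natDegree]
      exact Fintype.card_pos) (rootsPoly_sub_C_separable hj y)
  exact ⟨x, by simpa [IsRoot, sub_eq_zero] using hx⟩

/-- The polynomial of a Galois-stable group of elements of a Galois extension descends to the base
field. -/
theorem exists_map_eq_rootsPoly {k : Type*} [Field k] [Algebra k E] [IsGalois k E] {j : P →+ E}
    (hj : ∀ g : Gal(E/k), ∃ s : P → P, Function.Injective s ∧ ∀ a, g (j a) = j (s a)) :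
    ∃ f : k[X], f.Monic ∧ f.natDegree = Fintype.card P ∧ f.map (algebraMap k E) = rootsPoly j := by
  have hl : rootsPoly j ∈ Polynomial.lifts (algebraMap k E) := by
    rw [lifts_iff_coeff_lifts]
    intro n
    refine IntermediateField.mem_bot.1 ((InfiniteGalois.mem_bot_iff_fixed _).2 fun g => ?_)
    obtain ⟨s, hs, hg⟩ := hj g
    have : (rootsPoly j).map (g : E →+* E) = rootsPoly j := by
      simp only [rootsPoly, Polynomial.map_prod, Polynomial.map_sub, map_X, map_C]
      refine Fintype.prod_bijective s (Finite.injective_iff_bijective.1 hs) _ _ fun a => ?_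
      rw [← hg a]
      rfl
    have h := congrArg (fun q => q.coeff n) this
    simpa using h
  obtain ⟨f, hf, hd, hm⟩ := lifts_and_natDegree_eq_and_monic hl (rootsPoly_monic j)
  exact ⟨f, hm, hd.trans (rootsPoly_natDegree j), hf⟩

end AdditivePolynomial

/-! ### Growth of polynomials at a valuation -/

section UltrametricBound

open Polynomial

/-- The values of a monic polynomial of large valuation are dominated by the leading term. -/
theorem Valuation.exists_forall_lt_eval {k Γ : Type*} [Field k] [LinearOrderedCommGroupWithZero Γ]
    (w : Valuation k Γ) {f : k[X]} (hf : f.Monic) :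
    ∃ b : k, ∀ x, w b < w (f.eval x) → w (f.eval x) = w x ^ f.natDegree := by
  classical
  -- Including `1` ensures `1 ≤ w m`, so that powers of `w m` increase with the exponent.
  obtain ⟨m, hm, hmax⟩ := Finset.exists_max_image (insert 1 (f.support.image f.coeff)) w
    (Finset.insert_nonempty _ _)
  have h1 : 1 ≤ w m := by simpa using hmax 1 (Finset.mem_insert_self _ _)
  have hc : ∀ i, w (f.coeff i) ≤ w m := fun i => by
    by_cases hi : f.coeff i = 0
    · simp [hi]
    · exact hmax _ (Finset.mem_insert_of_mem
        (Finset.mem_image_of_mem _ (mem_support_iff.2 hi)))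
  -- If `w x ≤ w m`, every term of `f x` has value at most `w m ^ (deg f + 1)`; the bound therefore
  -- forces `w m < w x`, where the leading term dominates.
  refine ⟨m ^ (f.natDegree + 1), fun x hx => ?_⟩
  rcases le_or_gt (w x) (w m) with hxm | hxm
  · refine absurd hx (not_lt.2 ?_)
    rw [eval_eq_sum_range]
    refine w.map_sum_le fun i hi => ?_
    rw [map_mul, map_pow, map_pow, pow_succ']
    refine mul_le_mul' (hc i) ((pow_le_pow_left' hxm i).trans (pow_le_pow_right' h1 ?_))
    exact Nat.lt_succ_iff.1 (Finset.mem_range.1 hi)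
  · have hx1 : 1 < w x := h1.trans_lt hxm
    rw [eval_eq_sum_range, Finset.sum_range_succ, hf.coeff_natDegree, one_mul, ← map_pow]
    refine w.map_add_eq_of_lt_right ?_
    have hx0 : w (x ^ f.natDegree) ≠ 0 := by
      rw [map_pow]
      exact pow_ne_zero _ (zero_lt_one.trans hx1).ne'
    refine w.map_sum_lt hx0 fun i hi => ?_
    rw [map_mul, map_pow, map_pow]
    calc w (f.coeff i) * w x ^ i ≤ w m * w x ^ i := mul_le_mul_left (hc i) _
      _ < w x * w x ^ i := by
        have : 0 < w x ^ i := pow_pos (zero_lt_one.trans hx1) i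
        exact mul_lt_mul_of_pos_right hxm this
      _ = w x ^ (i + 1) := (pow_succ' _ _).symm
      _ ≤ w x ^ f.natDegree := pow_le_pow_right' hx1.le (Finset.mem_range.1 hi)

end UltrametricBound

/-! ### Additive Hilbert 90 and equivariant embeddings -/

section GaloisDescent

open Topology

variable {k L : Type*} [Field k] [Field L] [Algebra k L] [IsGalois k L]

/-- Every neighbourhood of the identity is controlled by a finite Galois quotient. -/
theorem exists_finite_galois_quotient {U : Set Gal(L/k)} (hU : U ∈ 𝓝 1) :
    ∃ N : IntermediateField k L, FiniteDimensional k N ∧ IsGalois k N ∧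
      ∃ r : Gal(L/k) →* Gal(N/k), Function.Surjective r ∧
        (∀ g (x : N), ((r g x : N) : L) = g x) ∧ ∀ g h, r g = r h → ∃ u ∈ U, h = g * u := by
  obtain ⟨N, hN, hN', hNU⟩ := (krullTopology_mem_nhds_one_iff_of_normal k L U).1 hU
  have : Algebra.IsSeparable k N := inferInstance
  have hr : ∀ (g : Gal(L/k)) (x : N), ((AlgEquiv.restrictNormalHom N g x : N) : L) = g x :=
    fun g x => g.restrictNormal_commutes N x
  refine ⟨N, hN, {}, AlgEquiv.restrictNormalHom N, AlgEquiv.restrictNormalHom_surjective L, hr,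
    fun g h hgh => ⟨g⁻¹ * h, hNU ?_, by group⟩⟩
  rw [SetLike.mem_coe, IntermediateField.mem_fixingSubgroup_iff]
  intro x hx
  have h1 : h x = g x := by rw [← hr h ⟨x, hx⟩, ← hr g ⟨x, hx⟩, hgh]
  rw [AlgEquiv.mul_apply, h1]
  exact g.symm_apply_apply x

/-- Additive Hilbert 90 for continuous cocycles. -/
theorem exists_forall_eq_apply_sub {d : Gal(L/k) → L} (hd : ∀ᶠ g in 𝓝 1, d g = 0)
    (hcoc : ∀ g h, d (g * h) = d g + g (d h)) : ∃ z, ∀ g, d g = g z - z := by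
  classical
  obtain ⟨N, _, _, r, hr, hrx, hN⟩ := exists_finite_galois_quotient hd
  obtain ⟨t, ht⟩ := Algebra.trace_surjective k N 1
  choose lift hl using hr
  have hD : ∀ g h : Gal(L/k), r g = r h → d g = d h := by
    intro g h hgh
    obtain ⟨u, hu, rfl⟩ := hN g h hgh
    have hu : d u = 0 := hu
    rw [hcoc, hu, map_zero, add_zero]
  have htr : ∑ s : Gal(N/k), ((s t : N) : L) = 1 := by
    have h := congrArg (algebraMap N L) (trace_eq_sum_automorphisms (K := k) t)
    rw [ht, map_one, map_one, map_sum] at h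
    exact h.symm
  -- Average of the cocycle against an element `t` of trace `1`: applying `g` and reindexing `s` by
  -- `r g * s` subtracts `d g` times the trace of `t`.
  refine ⟨-∑ s : Gal(N/k), d (lift s) * ((s t : N) : L), fun g => ?_⟩
  have hz : g (∑ s : Gal(N/k), d (lift s) * ((s t : N) : L)) =
      ∑ s : Gal(N/k), d (lift s) * ((s t : N) : L) - d g := by
    calc g (∑ s : Gal(N/k), d (lift s) * ((s t : N) : L))
        = ∑ s : Gal(N/k), (d (lift (r g * s)) - d g) *
            (((r g * s) t : N) : L) := by
          rw [map_sum]
          refine Finset.sum_congr rfl fun s _ => ?_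
          have h1 : d (lift (r g * s)) = d (g * lift s) :=
            hD _ _ (by rw [hl, map_mul, hl])
          rw [map_mul, h1, hcoc, add_sub_cancel_left]
          congr 1
          exact (hrx g (s t)).symm
      _ = ∑ s : Gal(N/k), (d (lift s) - d g) * ((s t : N) : L) :=
          Fintype.sum_equiv (Equiv.mulLeft (r g)) _ _ fun s => rfl
      _ = _ := by
          simp only [sub_mul, Finset.sum_sub_distrib, ← Finset.mul_sum, htr, mul_one]
  rw [map_neg, hz]
  ring

/-- An infinite space over a finite field has infinite rank, which exceeds the rank of any finite
space. -/
theorem exists_injective_linearMap_of_finite (K V W : Type*) [Field K] [Finite K] [AddCommGroup V]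
    [Module K V] [Finite V] [AddCommGroup W] [Module K W] [Infinite W] :
    ∃ ψ : V →ₗ[K] W, Function.Injective ψ := by
  have hW : Cardinal.aleph0 ≤ Module.rank K W := by
    by_contra! h
    have : FiniteDimensional K W := Module.rank_lt_aleph0_iff.1 h
    have : Finite W := Module.finite_of_finite K
    exact not_finite W
  have hV : Module.rank K V < Cardinal.aleph0 := Module.rank_lt_aleph0 K V
  exact lift_rank_le_iff_exists_linearMap.1
    ((Cardinal.lift_lt_aleph0.2 hV).le.trans (Cardinal.aleph0_le_lift.2 hW))

/-- A finite elementary abelian `p`-group embeds into every infinite field of characteristic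
`p`. -/
theorem exists_injective_addMonoidHom (p : ℕ) [Fact p.Prime] (F P : Type*) [Field F] [Infinite F]
    [CharP F p] [AddCommGroup P] [Finite P] (hP : ∀ x : P, p • x = 0) :
    ∃ ψ : P →+ F, Function.Injective ψ := by
  let _ : Module (ZMod p) P := AddCommGroup.zmodModule hP
  let _ : Algebra (ZMod p) F := ZMod.algebra F p
  obtain ⟨ψ, hψ⟩ := exists_injective_linearMap_of_finite (ZMod p) P F
  exact ⟨ψ.toAddMonoidHom, hψ⟩

/-- A finite elementary abelian `p`-group with continuous Galois action embeds equivariantly into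
the Galois extension. -/
theorem exists_equivariant_embedding (p : ℕ) [Fact p.Prime] [Infinite k] [CharP k p] {P : Type*}
    [AddCommGroup P] [Finite P] (hP : ∀ x : P, p • x = 0) {ρ : Gal(L/k) →* AddMonoid.End P}
    (hρ : ∀ᶠ g in 𝓝 1, ρ g = 1) :
    ∃ j : P →+ L, Function.Injective j ∧ ∀ g a, j (ρ g a) = g (j a) := by
  classical
  obtain ⟨N, _, _, r, hr, hrx, hN⟩ := exists_finite_galois_quotient hρ
  obtain ⟨b, hb⟩ := exists_linearIndependent_algEquiv_apply k N
  obtain ⟨ψ, hψ⟩ := exists_injective_addMonoidHom p k P hP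
  choose lift hl using hr
  have hR : ∀ g h : Gal(L/k), r g = r h → ρ g = ρ h := by
    intro g h hgh
    obtain ⟨u, hu, rfl⟩ := hN g h hgh
    have hu : ρ u = 1 := hu
    rw [map_mul, hu, mul_one]
  -- The elements `s b` are linearly independent. The coefficient at `s = 1` is `ψ a`, which gives
  -- injectivity; the twist by `s⁻¹` gives equivariance after reindexing.
  let j₀ : P → N := fun a => ∑ s : Gal(N/k), ψ (ρ (lift s⁻¹) a) • s b
  have hj₀ : ∀ a, j₀ a = 0 → a = 0 := by
    intro a ha
    have h1 := Fintype.linearIndependent_iff.1 hb _ ha 1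
    have h2 : ρ (lift (1 : Gal(N/k))⁻¹) = 1 := by
      rw [← map_one ρ]
      exact hR _ _ (by rw [hl, inv_one, map_one])
    rw [h2] at h1
    exact hψ (h1.trans (map_zero ψ).symm)
  let j : P →+ L := AddMonoidHom.mk' (fun a => (j₀ a : L)) fun x y => by
    simp only [j₀, map_add, add_smul, Finset.sum_add_distrib, AddMemClass.coe_add]
  refine ⟨j, (injective_iff_map_eq_zero j).2 fun a ha => hj₀ a (Subtype.ext ha), fun g a => ?_⟩
  have h1 : g (j a) = ((r g (j₀ a) : N) : L) :=
    (hrx g (j₀ a)).symm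
  rw [h1]
  change ((j₀ (ρ g a) : N) : L) = _
  congr 1
  simp only [j₀, map_sum, map_smul]
  refine (Fintype.sum_equiv (Equiv.mulLeft (r g)) _ _ fun s => ?_).symm
  have h2 : ρ (lift s⁻¹) = ρ (lift (r g * s)⁻¹) * ρ g := by
    rw [← map_mul]
    exact hR _ _ (by rw [hl, map_mul, hl]; group)
  rw [h2]
  rfl

variable {P : Type*} [AddCommGroup P] [TopologicalSpace P] [DiscreteTopology P]

theorem eventually_galois_apply_eq (x : L) (g : Gal(L/k)) : ∀ᶠ h in 𝓝 g, h x = g x := by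
  have ho := (stabilizer_isOpen_of_isIntegral (K := k) x).preimage (continuous_const_mul g⁻¹)
  refine Filter.mem_of_superset (ho.mem_nhds (by simp)) fun h hh => ?_
  have hh : g⁻¹ (h x) = x := hh
  exact (g.apply_symm_apply (h x)).symm.trans (congrArg g hh)

/-- The cocycle of an element all of whose translates differ from it by elements of an embedded
Galois module. -/
theorem exists_contCocycle_eq_apply_sub {ρ : Gal(L/k) →* AddMonoid.End P} {j : P →+ L}
    (hj : Function.Injective j) (hρ : ∀ g a, j (ρ g a) = g (j a)) {x : L}
    (hx : ∀ g : Gal(L/k), ∃ a, g x - x = j a) : ∃ c : contCocycles₁ ρ, ∀ g, j (c.1 g) = g x - x := by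
  choose c hc using hx
  refine ⟨⟨c, IsLocallyConstant.continuous ((IsLocallyConstant.iff_eventually_eq c).2 fun g => ?_),
    fun g h => hj ?_⟩, fun g => (hc g).symm⟩
  · filter_upwards [eventually_galois_apply_eq x g] with h hh
    exact hj (by rw [← hc, ← hc, hh])
  · rw [map_add, hρ, ← hc, ← hc, ← hc, map_sub, AlgEquiv.mul_apply]
    ring

end GaloisDescent

/-- Each stabilizer is open, and finiteness of `P` allows intersecting them all. -/
theorem IsContinuousAction.eventually_eq_one {G P : Type*} [Group G] [TopologicalSpace G]
    [AddCommGroup P] [TopologicalSpace P] [DiscreteTopology P] [Finite P]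
    {ρ : G →* AddMonoid.End P} (h : IsContinuousAction ρ) :
    ∀ᶠ g in nhds 1, ρ g = 1 := by
  have ha : ∀ a : P, ∀ᶠ g in nhds (1 : G), ρ g a = a := fun a => by
    have hc : Continuous fun g : G => ρ g a := h.comp (continuous_id.prodMk continuous_const)
    have := (hc.tendsto 1) (mem_nhds_discrete.2 (Set.mem_singleton (ρ 1 a)))
    rwa [map_one] at this
  filter_upwards [Filter.eventually_all.2 ha] with g hg
  exact AddMonoidHom.ext hg

/-! ### Cohomology classes as values modulo the additive polynomial -/

section LocalGlobal

open Polynomial Topology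

variable {k K P : Type*} [Field k] [Field K] [Algebra k K] [AddCommGroup P]

/-- A finite elementary abelian `p`-group with continuous action of the absolute Galois group is the
group of roots of an additive polynomial over the base field. -/
theorem exists_additive_polynomial (p : ℕ) [Fact p.Prime] [Infinite k] [CharP k p] [Fintype P]
    (hP : ∀ x : P, p • x = 0) {ρ : AbsGal k →* AddMonoid.End P} (hρ : ∀ᶠ g in 𝓝 1, ρ g = 1) :
    ∃ (j : P →+ SeparableClosure k) (f : k[X]), Function.Injective j ∧
      (∀ g a, j (ρ g a) = g (j a)) ∧ f.Monic ∧ f.natDegree = Fintype.card P ∧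
      f.map (algebraMap k (SeparableClosure k)) = rootsPoly j := by
  obtain ⟨j, hj, hjρ⟩ := exists_equivariant_embedding p hP hρ
  obtain ⟨f, hf, hd, hm⟩ := exists_map_eq_rootsPoly (k := k) (j := j) fun g =>
    ⟨ρ g, fun a b hab => hj (g.injective (by rw [← hjρ, ← hjρ, hab])), fun a => (hjρ g a).symm⟩
  exact ⟨j, f, hj, hjρ, hf, hd, hm⟩

/-- The transport of a group of elements along an embedding of separable closures. -/
noncomputable def transportRoots (e : SeparableClosure k →ₐ[k] SeparableClosure K)
    (j : P →+ SeparableClosure k) : P →+ SeparableClosure K :=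
  (e : SeparableClosure k →+* SeparableClosure K).toAddMonoidHom.comp j

variable (e : SeparableClosure k →ₐ[k] SeparableClosure K) {j : P →+ SeparableClosure k}

theorem transportRoots_apply (a : P) : transportRoots e j a = e (j a) := rfl

theorem transportRoots_injective (hj : Function.Injective j) :
    Function.Injective (transportRoots e j) :=
  e.injective.comp hj

theorem transportRoots_equivariant {ρ : AbsGal k →* AddMonoid.End P}
    (hjρ : ∀ g a, j (ρ g a) = g (j a)) (σ : AbsGal K) (a : P) :
    transportRoots e j (ρ (absGalRestrict e σ) a) = σ (transportRoots e j a) := by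
  rw [transportRoots_apply, hjρ, absGalRestrict_spec, transportRoots_apply]

theorem eq_algebraMap_of_fixed {F : Type*} [Field F] {x : SeparableClosure F}
    (hx : ∀ σ : AbsGal F, σ x = x) : ∃ t : F, algebraMap F (SeparableClosure F) t = x :=
  IntermediateField.mem_bot.1 ((InfiniteGalois.mem_bot_iff_fixed x).2 hx)

variable [Fintype P] {f : k[X]}

theorem eval_transportRoots (x : SeparableClosure k) :
    (rootsPoly (transportRoots e j)).eval (e x) = e ((rootsPoly j).eval x) := by
  have h : rootsPoly (transportRoots e j) = (rootsPoly j).map e.toRingHom :=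
    (rootsPoly_map j e.toRingHom).symm
  rw [h, eval_map]
  exact eval₂_hom e.toRingHom x

theorem map_eq_rootsPoly_transportRoots
    (hf : f.map (algebraMap k (SeparableClosure k)) = rootsPoly j) :
    (f.map (algebraMap k K)).map (algebraMap K (SeparableClosure K)) =
      rootsPoly (transportRoots e j) := by
  have h : rootsPoly (transportRoots e j) = (rootsPoly j).map e.toRingHom :=
    (rootsPoly_map j e.toRingHom).symm
  rw [h, ← hf, Polynomial.map_map, Polynomial.map_map, ← IsScalarTower.algebraMap_eq k K]
  congr 1
  exact RingHom.ext fun x => (e.commutes x).symm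

theorem algebraMap_eval_eq (hf : f.map (algebraMap k (SeparableClosure k)) = rootsPoly j) (u : K) :
    algebraMap K (SeparableClosure K) ((f.map (algebraMap k K)).eval u) =
      (rootsPoly (transportRoots e j)).eval (algebraMap K (SeparableClosure K) u) := by
  rw [← map_eq_rootsPoly_transportRoots e hf, eval_map (algebraMap K (SeparableClosure K)),
    eval₂_hom]

theorem eval_zero_map_eq_zero (e : SeparableClosure k →ₐ[k] SeparableClosure K)
    (hf : f.map (algebraMap k (SeparableClosure k)) = rootsPoly j) :
    (f.map (algebraMap k K)).eval 0 = 0 := by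
  refine (algebraMap K (SeparableClosure K)).injective ?_
  rw [algebraMap_eval_eq e hf, map_zero, eval_rootsPoly_eq_zero_iff]
  exact ⟨0, (map_zero _).symm⟩

theorem eval_zero_derivative_map_ne_zero (e : SeparableClosure k →ₐ[k] SeparableClosure K)
    (hj : Function.Injective j)
    (hf : f.map (algebraMap k (SeparableClosure k)) = rootsPoly j) :
    (f.map (algebraMap k K)).derivative.eval 0 ≠ 0 := by
  intro h
  refine eval_zero_derivative_rootsPoly_ne_zero (transportRoots_injective e hj) ?_
  rw [← map_eq_rootsPoly_transportRoots e hf, derivative_map (f.map (algebraMap k K)),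
    ← map_zero (algebraMap K (SeparableClosure K)), eval_map (algebraMap K (SeparableClosure K)),
    eval₂_hom, h]

variable [TopologicalSpace P] [DiscreteTopology P] {ρ : AbsGal k →* AddMonoid.End P}

/-- Every cocycle of the absolute Galois group of `K` comes from an element with value in `K` under
the additive polynomial. -/
theorem exists_eval_eq_of_cocycle (hj : Function.Injective j) (hjρ : ∀ g a, j (ρ g a) = g (j a))
    (c : contCocycles₁ (ρ.comp (absGalRestrict e).toMonoidHom)) :
    ∃ (z : SeparableClosure K) (t : K), (∀ σ, transportRoots e j (c.1 σ) = σ z - z) ∧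
      (rootsPoly (transportRoots e j)).eval z = algebraMap K (SeparableClosure K) t := by
  have h1 : c.1 1 = 0 := by simpa using c.2.2 1 1
  have hd : ∀ᶠ σ in 𝓝 (1 : AbsGal K), transportRoots e j (c.1 σ) = 0 := by
    have := (c.2.1.tendsto 1) (mem_nhds_discrete.2 (Set.mem_singleton (c.1 1)))
    filter_upwards [this] with σ hσ
    have hσ : c.1 σ = c.1 1 := hσ
    rw [hσ, h1, map_zero]
  obtain ⟨z, hz⟩ := exists_forall_eq_apply_sub hd fun g h => by
    rw [c.2.2, map_add, ← transportRoots_equivariant e hjρ]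
    rfl
  -- The polynomial is Galois invariant and `σ z - z` is a root, so additivity makes its value at
  -- `z` fixed by every `σ`.
  obtain ⟨t, ht⟩ := eq_algebraMap_of_fixed (x := (rootsPoly (transportRoots e j)).eval z)
    fun σ => by
      have hσ : (rootsPoly (transportRoots e j)).map (σ : SeparableClosure K →+* SeparableClosure K)
          = rootsPoly (transportRoots e j) := by
        simp only [rootsPoly, Polynomial.map_prod, Polynomial.map_sub, map_X, map_C]
        have hinj : Function.Injective (ρ (absGalRestrict e σ)) := fun a b hab => hj <|
          (absGalRestrict e σ).injective (by rw [← hjρ, ← hjρ, hab])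
        refine Fintype.prod_bijective _ (Finite.injective_iff_bijective.1 hinj) _ _ fun a => ?_
        rw [transportRoots_equivariant e hjρ]
        rfl
      have h2 : σ ((rootsPoly (transportRoots e j)).eval z) =
          (rootsPoly (transportRoots e j)).eval (σ z) := by
        conv_rhs => rw [← hσ]
        rw [eval_map]
        exact (eval₂_hom (σ : SeparableClosure K →+* SeparableClosure K) z).symm
      have h3 : (rootsPoly (transportRoots e j)).eval (σ z - z) = 0 :=
        (eval_rootsPoly_eq_zero_iff _).2 ⟨c.1 σ, (hz σ).symm⟩
      rw [eval_rootsPoly_sub (transportRoots_injective e hj), sub_eq_zero] at h3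
      rw [h2, h3]
  exact ⟨z, t, hz, ht.symm⟩

/-- Two cocycles attached to elements `x` and `z` are cohomologous over `K` if the additive
polynomial takes the value `f x - f z` in `K`. -/
theorem pullback_sub_mem_contCoboundaries (hj : Function.Injective j)
    (hjρ : ∀ g a, j (ρ g a) = g (j a))
    (hf : f.map (algebraMap k (SeparableClosure k)) = rootsPoly j)
    {c : contCocycles₁ ρ} {x : SeparableClosure k} {y : k} (hc : ∀ g, j (c.1 g) = g x - x)
    (hx : (rootsPoly j).eval x = algebraMap k (SeparableClosure k) y)
    {c' : contCocycles₁ (ρ.comp (absGalRestrict e).toMonoidHom)} {z : SeparableClosure K} {t : K}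
    (hc' : ∀ σ, transportRoots e j (c'.1 σ) = σ z - z)
    (hz : (rootsPoly (transportRoots e j)).eval z = algebraMap K (SeparableClosure K) t)
    (hu : ∃ u : K, (f.map (algebraMap k K)).eval u = algebraMap k K y - t) :
    contCocycles₁Pullback ρ (absGalRestrict e) c - c' ∈
      contCoboundaries₁ (ρ.comp (absGalRestrict e).toMonoidHom) := by
  have hJ := transportRoots_injective e hj
  obtain ⟨u, hu⟩ := hu
  -- So `e x - z - u` is the image of some `a` in `P`; as `u` is fixed by `Gal(K)`, the two cocycles
  -- differ by the coboundary of `a`.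
  have h0 : (rootsPoly (transportRoots e j)).eval
      (e x - z - algebraMap K (SeparableClosure K) u) = 0 := by
    rw [eval_rootsPoly_sub hJ, eval_rootsPoly_sub hJ, eval_transportRoots, hx, hz,
      ← algebraMap_eval_eq e hf, hu, map_sub, e.commutes,
      ← IsScalarTower.algebraMap_apply k K (SeparableClosure K), sub_self]
  obtain ⟨a, ha⟩ := (eval_rootsPoly_eq_zero_iff _).1 h0
  refine ⟨a, fun σ => hJ ?_⟩
  have h1 : (contCocycles₁Pullback ρ (absGalRestrict e) c - c').1 σ =
      c.1 (absGalRestrict e σ) - c'.1 σ := rfl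
  have h2 : transportRoots e j (c.1 (absGalRestrict e σ)) = σ (e x) - e x := by
    rw [transportRoots_apply, hc, map_sub, absGalRestrict_spec]
  have h3 : transportRoots e j ((ρ.comp (absGalRestrict e).toMonoidHom) σ a) =
      σ (transportRoots e j a) := transportRoots_equivariant e hjρ σ a
  rw [h1, map_sub, map_sub, h2, hc', h3, ← ha, map_sub, map_sub, AlgEquiv.commutes]
  ring

/-- Every element of the base field is the value of the additive polynomial at an element of the
separable closure, which defines a cocycle. -/
theorem exists_contCocycle_of_value [Infinite k] (hj : Function.Injective j)
    (hjρ : ∀ g a, j (ρ g a) = g (j a))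
    (hf : f.map (algebraMap k (SeparableClosure k)) = rootsPoly j) (y : k) :
    ∃ (c : contCocycles₁ ρ) (x : SeparableClosure k), (∀ g, j (c.1 g) = g x - x) ∧
      (rootsPoly j).eval x = algebraMap k (SeparableClosure k) y := by
  have : Infinite (SeparableClosure k) :=
    Infinite.of_injective _ (algebraMap k (SeparableClosure k)).injective
  obtain ⟨x, hx⟩ := exists_eval_rootsPoly_eq hj (algebraMap k (SeparableClosure k) y)
  obtain ⟨c, hc⟩ := exists_contCocycle_eq_apply_sub hj hjρ (x := x) fun g => by
    refine (eval_rootsPoly_eq_zero_iff j).1 ?_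
    have hg : g ((rootsPoly j).eval x) = (rootsPoly j).eval (g x) := by
      rw [← hf, eval_map_algebraMap, eval_map_algebraMap, aeval_algHom_apply]
    rw [eval_rootsPoly_sub hj, ← hg, hx, AlgEquiv.commutes, sub_self]
  exact ⟨c, x, hc, hx⟩

/-- If the cocycles of two values of the additive polynomial are cohomologous then the difference of
the values is a value over the base field. -/
theorem exists_eval_eq_sub_of_mem_contCoboundaries (hj : Function.Injective j)
    (hjρ : ∀ g a, j (ρ g a) = g (j a))
    (hf : f.map (algebraMap k (SeparableClosure k)) = rootsPoly j)
    {c c' : contCocycles₁ ρ} {x x' : SeparableClosure k} {y y' : k}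
    (hc : ∀ g, j (c.1 g) = g x - x)
    (hx : (rootsPoly j).eval x = algebraMap k (SeparableClosure k) y)
    (hc' : ∀ g, j (c'.1 g) = g x' - x')
    (hx' : (rootsPoly j).eval x' = algebraMap k (SeparableClosure k) y')
    (h : c - c' ∈ contCoboundaries₁ ρ) : ∃ r : k, f.eval r = y - y' := by
  obtain ⟨a, ha⟩ := h
  -- Correcting `x - x'` by the root `j a` makes it Galois invariant without changing its value
  -- under `f`.
  have hfix : ∀ g : AbsGal k, g (x - x' - j a) = x - x' - j a := fun g => by
    have h1 : c.1 g - c'.1 g = ρ g a - a := ha g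
    have h2 := congrArg j h1
    rw [map_sub, map_sub, hc, hc', hjρ] at h2
    rw [map_sub, map_sub]
    linear_combination h2
  obtain ⟨r, hr⟩ := eq_algebraMap_of_fixed hfix
  refine ⟨r, (algebraMap k (SeparableClosure k)).injective ?_⟩
  have h0 : (rootsPoly j).eval (j a) = 0 := (eval_rootsPoly_eq_zero_iff j).2 ⟨a, rfl⟩
  have h3 : algebraMap k (SeparableClosure k) (f.eval r) =
      (rootsPoly j).eval (algebraMap k (SeparableClosure k) r) := by
    rw [← hf, eval_map, eval₂_hom]
  rw [h3, hr, eval_rootsPoly_sub hj, eval_rootsPoly_sub hj, h0, hx, hx', sub_zero, map_sub]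

end LocalGlobal

/-! ### Surjectivity and infinite kernel -/

section Domination

open Polynomial Topology

theorem ContH1.pullbackPi_mk {G J P : Type*} {H : J → Type*} [Group G] [TopologicalSpace G]
    [∀ i, Group (H i)] [∀ i, TopologicalSpace (H i)] [AddCommGroup P] [TopologicalSpace P]
    [DiscreteTopology P] (ρ : G →* AddMonoid.End P) (φ : ∀ i, H i →ₜ* G) (c : contCocycles₁ ρ)
    (i : J) : ContH1.pullbackPi ρ φ (c : ContH1 ρ) i =
      (contCocycles₁Pullback ρ (φ i) c : ContH1 (ρ.comp (φ i).toMonoidHom)) :=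
  rfl

/-- An element of the value group is a ratio of values, hence itself a value; a `p`-th root of it
among the values would be a root in the value group. -/
theorem Valuation.exists_map_ne_pow {k Γ : Type*} [Field k] [LinearOrderedCommGroupWithZero Γ]
    {w : Valuation k Γ} {p : ℕ} (h : ¬ w.HasPDivisibleValueGroup p) :
    ∃ a : k, w a ≠ 0 ∧ ∀ x : k, w x ^ p ≠ w a := by
  unfold HasPDivisibleValueGroup at h
  push Not at h
  obtain ⟨⟨γ, hγ⟩, h⟩ := h
  obtain ⟨a, ha, b, hab⟩ := (MonoidWithZeroHom.mem_valueGroup_iff_of_comm _).1 hγ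
  have ha : w a ≠ 0 := ha
  have hab : w a * γ = w b := hab
  have hγa : w (b / a) = γ := by rw [map_div₀, ← hab, mul_div_cancel_left₀ _ ha]
  refine ⟨b / a, hγa ▸ γ.ne_zero, fun x hx => ?_⟩
  rw [hγa] at hx
  -- For `p = 0` the equation would force `γ = 1`, which is a zeroth power.
  have hp : p ≠ 0 := by
    rintro rfl
    refine h 1 (Subtype.ext (Units.ext ?_))
    simpa using hx
  have hx0 : w x ≠ 0 := fun h0 => γ.ne_zero (by rw [← hx, h0, zero_pow hp])
  refine h ⟨Units.mk0 (w x) hx0, MonoidWithZeroHom.mem_valueGroup _ ⟨x, rfl⟩⟩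
    (Subtype.ext (Units.ext ?_))
  exact hx

theorem dvd_card_of_forall_nsmul_eq_zero (p : ℕ) [Fact p.Prime] {P : Type*} [AddCommGroup P]
    [Fintype P] [Nontrivial P] (hP : ∀ x : P, p • x = 0) : p ∣ Fintype.card P := by
  obtain ⟨x, hx⟩ := exists_ne (0 : P)
  rw [← addOrderOf_eq_prime (hP x) hx]
  exact addOrderOf_dvd_card

variable {k : Type*} [Field k] {S : Type*} [Finite S] {Γ : S → Type*}
  [∀ i, LinearOrderedCommGroupWithZero (Γ i)]

theorem isPDominating_absGalRestrict (p : ℕ) [Fact p.Prime] [CharP k p]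
    (v : ∀ i, Valuation k (Γ i)) [∀ i, (v i).RankOne]
    (hv : Pairwise fun i j => ¬ (v i).IsEquiv (v j))
    (e : ∀ i, SeparableClosure k →ₐ[k] SeparableClosure (v i).Completion) :
    IsPDominating p (fun i => absGalRestrict (e i)) := by
  intro P _ _ _ _ ρ hρ hP b
  -- For empty `S` the target is trivial, and `k` may be finite, so the embedding of `P` may not
  -- exist.
  obtain hS | ⟨⟨i₀⟩⟩ := isEmpty_or_nonempty S
  · exact ⟨0, funext fun i => hS.elim i⟩
  have : Infinite k := (v i₀).infinite_of_rankOne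
  have := Fintype.ofFinite P
  obtain ⟨j, f, hj, hjρ, -, -, hf⟩ := exists_additive_polynomial p hP hρ.eventually_eq_one
  choose c hc using fun i => QuotientAddGroup.mk_surjective (b i)
  choose z t hz ht using fun i => exists_eval_eq_of_cocycle (e i) hj hjρ (c i)
  -- The elements congruent to `t i` modulo `f(k_v)` form a neighbourhood of `t i`; any `y` in `k`
  -- lying in all of them gives the required class.
  have hnear : ∀ i, {s | ∃ u, (f.map (algebraMap k (v i).Completion)).eval u = s - t i} ∈
      𝓝 (t i) := fun i => by
    have h := (v i).eventually_exists_eval_eq (eval_zero_map_eq_zero (e i) hf)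
      (eval_zero_derivative_map_ne_zero (e i) hj hf)
    have hs : Filter.Tendsto (fun s => s - t i) (𝓝 (t i)) (𝓝 0) := by
      have := (continuous_sub_right (t i)).tendsto (t i)
      rwa [sub_self] at this
    exact hs.eventually h
  choose y₀ ε hε hball using fun i => (v i).exists_ball_subset_of_mem_nhds (hnear i)
  obtain ⟨y, hy⟩ := AbsoluteValue.exists_forall_sub_lt
    (fun i => (v i).toAbsoluteValue_isNontrivial)
    (fun i l hil h => hv hil ((v i).isEquiv_of_toAbsoluteValue_isEquiv (v l) h)) y₀ hε
  obtain ⟨c₀, x, hc₀, hx⟩ := exists_contCocycle_of_value hj hjρ hf y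
  refine ⟨c₀, funext fun i => ?_⟩
  rw [ContH1.pullbackPi_mk, ← hc i, eq_comm, QuotientAddGroup.eq, neg_add_eq_sub]
  exact pullback_sub_mem_contCoboundaries (e i) hj hjρ hf hc₀ hx (hz i) (ht i) (hball i y (hy i))

theorem infinite_ker_pullbackPi_absGalRestrict (p : ℕ) [Fact p.Prime] [CharP k p]
    (v : ∀ i, Valuation k (Γ i)) [∀ i, (v i).RankOne]
    (hv : Pairwise fun i j => ¬ (v i).IsEquiv (v j))
    (e : ∀ i, SeparableClosure k →ₐ[k] SeparableClosure (v i).Completion)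
    {Δ : Type*} [LinearOrderedCommGroupWithZero Δ] (w : Valuation k Δ) [w.RankOne]
    (hwv : ∀ i, ¬ w.IsEquiv (v i)) (hw : ¬ w.HasPDivisibleValueGroup p)
    {P : Type*} [AddCommGroup P] [Finite P] [Nontrivial P] [TopologicalSpace P]
    [DiscreteTopology P] {ρ : AbsGal k →* AddMonoid.End P} (hρ : IsContinuousAction ρ)
    (hP : ∀ x : P, p • x = 0) :
    Infinite (ContH1.pullbackPi ρ fun i => absGalRestrict (e i)).ker := by
  have : Infinite k := w.infinite_of_rankOne
  have := Fintype.ofFinite P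
  obtain ⟨j, f, hj, hjρ, hfm, hfd, hf⟩ := exists_additive_polynomial p hP hρ.eventually_eq_one
  obtain ⟨m, hm⟩ := dvd_card_of_forall_nsmul_eq_zero p hP
  obtain ⟨B, hB⟩ := w.exists_forall_lt_eval hfm
  obtain ⟨a, ha0, ha⟩ := Valuation.exists_map_ne_pow hw
  obtain ⟨b, hb⟩ := w.toAbsoluteValue_isNontrivial.exists_abv_gt_one
  have hb1 : 1 < w b := by
    rw [← map_one w, ← w.toAbsoluteValue_lt_iff, map_one]
    exact hb
  have hapos : 0 < w.toAbsoluteValue a :=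
    w.toAbsoluteValue.pos ((Valuation.ne_zero_iff w).1 ha0)
  -- This `N` puts every `A n` above the bound `B`. The exponents of `b` in `A n` are multiples of
  -- `p`, so `w (A n)` remains a non-`p`-th power.
  obtain ⟨N, hN⟩ := pow_unbounded_of_one_lt (w.toAbsoluteValue B / w.toAbsoluteValue a) hb
  have hp : 0 < p := (Fact.out : p.Prime).pos
  let A : ℕ → k := fun n => a * b ^ (p * (N + n))
  have hA : ∀ n, w (A n) = w a * w b ^ (p * (N + n)) := fun n => by
    simp only [A, map_mul, map_pow]
  have hA0 : ∀ n, w (A n) ≠ 0 := fun n => by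
    rw [hA]
    exact mul_ne_zero ha0 (pow_ne_zero _ (zero_lt_one.trans hb1).ne')
  have hAmono : ∀ n n', n < n' → w (A n) < w (A n') := fun n n' h => by
    rw [hA, hA]
    refine mul_lt_mul_of_pos_left ?_ (zero_lt_iff.2 ha0)
    exact pow_lt_pow_right₀ hb1 (Nat.mul_lt_mul_of_pos_left (Nat.add_lt_add_left h N) hp)
  have hAB : ∀ n, w B < w (A n) := fun n => by
    rw [← w.toAbsoluteValue_lt_iff, map_mul, map_pow]
    rw [div_lt_iff₀' hapos] at hN
    refine hN.trans_le (mul_le_mul_of_nonneg_left (pow_le_pow_right₀ hb.le ?_) hapos.le)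
    exact (Nat.le_add_right N n).trans (Nat.le_mul_of_pos_left _ hp)
  have hApow : ∀ n x, w x ^ Fintype.card P ≠ w (A n) := fun n x h => by
    rw [hm, hA] at h
    refine ha (x ^ m / b ^ (N + n)) ?_
    rw [map_div₀, map_pow, map_pow, div_pow, ← pow_mul, ← pow_mul, mul_comm m p, h,
      mul_comm (N + n) p, mul_div_cancel_right₀ _ (pow_ne_zero _ (zero_lt_one.trans hb1).ne')]
  have hnear : ∀ i, {s | ∃ u, (f.map (algebraMap k (v i).Completion)).eval u = s} ∈
      𝓝 (0 : (v i).Completion) := fun i =>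
    (v i).eventually_exists_eval_eq (eval_zero_map_eq_zero (e i) hf)
      (eval_zero_derivative_map_ne_zero (e i) hj hf)
  choose y₀ ε hε hball using fun i => (v i).exists_ball_subset_of_mem_nhds (hnear i)
  -- The index `none` stands for `w`, so that one application of weak approximation treats it
  -- together with `S`.
  let α : Option S → AbsoluteValue k ℝ := fun o =>
    o.elim w.toAbsoluteValue fun i => (v i).toAbsoluteValue
  have hα : ∀ o, (α o).IsNontrivial := by
    rintro (_ | i)
    · exact w.toAbsoluteValue_isNontrivial
    · exact (v i).toAbsoluteValue_isNontrivial
  have hαα : Pairwise fun o o' => ¬ (α o).IsEquiv (α o') := by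
    rintro (_ | i) (_ | l) hil h
    · exact hil rfl
    · exact hwv l (w.isEquiv_of_toAbsoluteValue_isEquiv (v l) h)
    · exact hwv i (w.isEquiv_of_toAbsoluteValue_isEquiv (v i) h.symm)
    · exact hv (fun hh => hil (congrArg some hh))
        ((v i).isEquiv_of_toAbsoluteValue_isEquiv (v l) h)
  have happrox : ∀ n, ∃ y : k, w (y - A n) < w (A n) ∧
      ∀ i, (v i).toAbsoluteValue (y - y₀ i) < ε i := fun n => by
    obtain ⟨y, hy⟩ := AbsoluteValue.exists_forall_sub_lt hα hαα (fun o => o.elim (A n) y₀)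
      (ε := fun o => o.elim (w.toAbsoluteValue (A n)) ε) (by
        rintro (_ | i)
        · exact w.toAbsoluteValue.pos ((Valuation.ne_zero_iff w).1 (hA0 n))
        · exact hε i)
    exact ⟨y, w.toAbsoluteValue_lt_iff.1 (hy none), fun i => hy (some i)⟩
  choose y hyA hyv using happrox
  have hy : ∀ n, w (y n) = w (A n) := fun n => Valuation.map_eq_of_sub_lt w (hyA n)
  choose c x hc hx using fun n => exists_contCocycle_of_value (ρ := ρ) hj hjρ hf (y n)
  have hker : ∀ n, (c n : ContH1 ρ) ∈ (ContH1.pullbackPi ρ fun i => absGalRestrict (e i)).ker :=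
    fun n => by
      refine AddMonoidHom.mem_ker.2 (funext fun i => ?_)
      rw [ContH1.pullbackPi_mk, Pi.zero_apply, QuotientAddGroup.eq_zero_iff]
      -- Comparison with the zero cocycle, attached to `z = 0` and `t = 0`: local triviality only
      -- requires `y n` to lie in `f(k_v)`.
      have h := pullback_sub_mem_contCoboundaries (e i) (c' := 0) (z := 0) (t := 0) hj hjρ hf
        (hc n) (hx n) (fun σ => by
          rw [map_zero, sub_zero]
          exact map_zero _)
        ((eval_rootsPoly_eq_zero_iff _).2 ⟨0, (map_zero _).symm⟩ |>.trans (map_zero _).symm) (by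
          rw [sub_zero]
          exact hball i (y n) (hyv n i))
      rwa [sub_zero] at h
  have hne : ∀ n n', n < n' → (c n' : ContH1 ρ) ≠ c n := fun n n' hnn h => by
    rw [eq_comm, QuotientAddGroup.eq, neg_add_eq_sub] at h
    obtain ⟨r, hr⟩ := exists_eval_eq_sub_of_mem_contCoboundaries hj hjρ hf (hc n') (hx n')
      (hc n) (hx n) h
    -- The strictly larger value `w (y n')` determines that of the difference; it exceeds `w B`, so
    -- it would equal `w r ^ |P|`.
    have hw' : w (f.eval r) = w (A n') := by
      rw [hr, ← hy n']
      exact w.map_sub_eq_of_lt_left (by rw [hy n, hy n']; exact hAmono n n' hnn)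
    refine hApow n' r ?_
    rw [← hw', ← hfd]
    exact (hB r (by rw [hw']; exact hAB n')).symm
  refine Infinite.of_injective (fun n : ℕ => (⟨(c n : ContH1 ρ), hker n⟩ :
    (ContH1.pullbackPi ρ fun i => absGalRestrict (e i)).ker)) fun n n' h => ?_
  have h' : (c n : ContH1 ρ) = c n' := congrArg Subtype.val h
  rcases lt_trichotomy n n' with hlt | heq | hgt
  · exact absurd h'.symm (hne n n' hlt)
  · exact heq
  · exact absurd h' (hne n' n hgt)

end Domination

theorem proposition2p4
    (p : ℕ) [Fact p.Prime] (k : Type*) [Field k] [CharP k p]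
    -- a finite family of pairwise non-equivalent valuations of rank 1
    (S : Type*) [Finite S] (Γ : S → Type*) [∀ i, LinearOrderedCommGroupWithZero (Γ i)]
    (v : ∀ i, Valuation k (Γ i)) [∀ i, (v i).RankOne]
    (hv : Pairwise fun i j => ¬ (v i).IsEquiv (v j))
    -- embeddings of separable closures, which define the maps Gal(k_v) → Gal(k)
    (e : ∀ i, SeparableClosure k →ₐ[k] SeparableClosure (v i).Completion) :
    IsPDominating p (fun i => absGalRestrict (e i)) ∧
    ∀ (Δ : Type*) [LinearOrderedCommGroupWithZero Δ] (w : Valuation k Δ) [w.RankOne],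
      (∀ i, ¬ w.IsEquiv (v i)) → ¬ w.HasPDivisibleValueGroup p →
        IsStronglyPDominating p (fun i => absGalRestrict (e i)) := by
  refine ⟨isPDominating_absGalRestrict p v hv e, ?_⟩
  intro Δ _ w _ hwv hw P _ _ _ _ _ ρ hρ hP
  exact ⟨isPDominating_absGalRestrict p v hv e P ρ hρ hP,
    infinite_ker_pullbackPi_absGalRestrict p v hv e w hwv hw hρ hP⟩
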